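/- **Conventions.** A globular set $X$ consists of sets $X_n$ ($n\in\mathbb N$) and maps $\mathrm{src},\mathrm{tgt}:X_{n+1}\to X_n$ with $\mathrm{src}\,\mathrm{src}=\mathrm{src}\,\mathrm{tgt}$ and $\mathrm{tgt}\,\mathrm{src}=\mathrm{tgt}\,\mathrm{tgt}$; $\mathbf{Glob}$ is the category of globular sets. Batanin trees are generated inductively by $\mathrm{br}[B_1,\dots,B_k]$ for lists of Batanin trees; $\dim B$ is the height of $B$. Positions of trees are generated by $\mathrm{here}\in \mathrm{Pos}_0(B)$ for every $B$, $\mathrm{inr}\,p\in\mathrm{Pos}_n(\mathrm{br}[B,B_1,\dots,B_k])$ for $p\in \mathrm{Pos}_n(\mathrm{br}[B_1,\dots,B_k])$, and $\mathrm{inl}\,q\in \mathrm{Pos}_{n+1}(\mathrm{br}[B,B_1,\dots,B_k])$ for $q\in\mathrm{Pos}_n(B)$. They form a globular set $\mathrm{Pos}(B)$ (the pasting diagram of $B$) by: source and target commute with $\mathrm{inr}$, and with $\mathrm{inl}$ on positions $q$ of positive dimension, while for $q$ of dimension $0$ the source of $\mathrm{inl}\,q$ is $\mathrm{here}$ and its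 target is $\mathrm{inr}(\mathrm{here})$. A position is *source* (resp. *target*) *boundary* if it is not the target (resp. source) of another position. **Finite-dimensional computads.** By recursion on $n$ one defines categories $\mathbf{Comp}_n$, functors $\mathrm{Cell}_n,\mathrm{Sph}_n:\mathbf{Comp}_n\to\mathbf{Set}$ and $\mathrm{Free}_n:\mathbf{Glob}\to\mathbf{Comp}_n$, and for each tree $B$ the *full* $n$-spheres of $\mathrm{Free}_n\mathrm{Pos}(B)$. * $n=0$: $\mathbf{Comp}_0=\mathbf{Set}$, $\mathrm{Cell}_0(C)=C$, $\mathrm{Sph}_0(C)=C\times C$, $\mathrm{Free}_0X=X_0$; a sphere $(a,b)$ of $\mathrm{Pos}_0(B)$ is full if $a$ is source boundary and $b$ is target boundary. The sphere of a pair $(a,b)\in X_0\times X_0$ is $(a,b)$. * $n\ge 1$: an $n$-computad is a triple $C=(C_{n-1},V^C_n,\phi^C_n)$ of an $(n-1)$-computad, a set of generators and a function $\phi^C_n:V^C_n\to\mathrm{Sph}_{n-1}(C_{n-1})$. Its cells, their boundaries, and homomorphisms are defined by mutual induction. A homomorphism $D\to C$ is a pair of $\sigma_{n-1}:D_{n-1}\to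 C_{n-1}$ and $\sigma_V:V^D_n\to\mathrm{Cell}_n(C)$ with $\mathrm{ty}(\sigma_V(v))=\mathrm{Sph}_{n-1}(\sigma_{n-1})(\phi^D_n(v))$. The cells of $C$ are $\mathrm{var}\,v$ for $v\in V^C_n$, with boundary $\mathrm{ty}(\mathrm{var}\,v)=\phi^C_n(v)$, and $\mathrm{coh}(B,A,\tau)$ for $B$ a Batanin tree with $\dim B\le n$, $A$ a full $(n-1)$-sphere of $\mathrm{Free}_{n-1}\mathrm{Pos}(B)$ and $\tau:\mathrm{Free}_n\mathrm{Pos}(B)\to C$ a homomorphism, with boundary $\mathrm{Sph}_{n-1}(\tau_{n-1})(A)$. A homomorphism $\sigma$ acts by $\mathrm{var}\,v\mapsto\sigma_V(v)$ and $\mathrm{coh}(B,A,\tau)\mapsto\mathrm{coh}(B,A,\sigma\circ\tau)$, where $\sigma\circ\tau=(\sigma_{n-1}\circ\tau_{n-1},\ \mathrm{Cell}_n(\sigma)\circ\tau_V)$. An $n$-sphere is a triple $(A,a,b)$ with $A\in\mathrm{Sph}_{n-1}(C_{n-1})$ and $a,b\in\mathrm{Cell}_n(C)$ of boundary $A$.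 $\mathrm{Free}_nX=(\mathrm{Free}_{n-1}X,X_n,\phi)$, where $\phi(x)$ is the sphere of the pair $(\mathrm{src}\,x,\mathrm{tgt}\,x)$, and the sphere of a parallel pair $(p,q)$ of $n$-cells of $X$ is $(\phi(p),\mathrm{var}\,p,\mathrm{var}\,q)$; $\mathrm{Free}_n f=(\mathrm{Free}_{n-1}f,\ x\mapsto\mathrm{var}\,f_n(x))$. The support of $\mathrm{var}\,v$ is $\{v\}$ and that of $\mathrm{coh}(B,A,\tau)$ is $\bigcup_{p\in\mathrm{Pos}_n(B)}\mathrm{supp}(\tau_V(p))$. A sphere $(A,a,b)$ of $\mathrm{Free}_n\mathrm{Pos}(B)$ is full if $A$ is full, $\mathrm{supp}(a)$ is the set of source boundary $n$-positions of $B$, and $\mathrm{supp}(b)$ is the set of target boundary $n$-positions of $B$. **Computads and $\omega$-categories.** $\mathbf{Comp}$ is the limit of the categories $\mathbf{Comp}_n$ along the forgetful functors $C\mapsto C_{n-1}$. The functors $\mathrm{Free}_n$ induce $\mathrm{Free}:\mathbf{Glob}\to\mathbf{Comp}$, and the sets $\mathrm{Cell}_n(C_n)$, with source and target the two components of the boundary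 sphere, form a functor $\mathrm{Cell}:\mathbf{Comp}\to\mathbf{Glob}$. $\mathrm{Free}$ is left adjoint to $\mathrm{Cell}$, with unit sending a cell to the corresponding generator and counit $\varepsilon_C$ sending the generator of $\mathrm{Free}(\mathrm{Cell}\,C)$ given by a cell $c$ of $C$ to $c$. Let $\mathrm{fc}^w$ be the induced monad on $\mathbf{Glob}$, let $\omega\mathbf{Cat}$ be the category of $\mathrm{fc}^w$-algebras (weak $\omega$-categories) and their homomorphisms (strict functors), and let $K^w:\mathbf{Comp}\to\omega\mathbf{Cat}$, $C\mapsto(\mathrm{Cell}\,C,\ \mathrm{Cell}(\varepsilon_C))$, be the comparison functor. **Proposition.** The comparison functor $K^w:\mathbf{Comp}\to\omega\mathbf{Cat}$ is full and faithful. That is, for all computads $C,D$, the map $\sigma\mapsto K^w\sigma$ is a bijection from homomorphisms of computads $C\to D$ to strict functors $K^wC\to K^wD$ between the weak $\omega$-categories they generate. -/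

import Mathlib

open CategoryTheory

-- With this instance switched off, `⟶` is found through the category structure directly.
attribute [-instance] CategoryTheory.catToReflQuiver

universe u

namespace WeakOmega

/-! ## Globular sets -/

/-- A globular set: a set of `n`-cells for every `n`, with source and target maps satisfying the
globularity conditions. -/
structure Glob : Type (u + 1) where
  cell : ℕ → Type u
  src : ∀ {n : ℕ}, cell (n + 1) → cell n
  tgt : ∀ {n : ℕ}, cell (n + 1) → cell n
  src_src : ∀ {n : ℕ} (x : cell (n + 2)), src (src x) = src (tgt x)
  tgt_src : ∀ {n : ℕ} (x : cell (n + 2)), tgt (src x) = tgt (tgt x)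

namespace Glob

/-- Morphisms of globular sets: dimensionwise functions commuting with source and target. -/
@[ext]
structure Hom (X Y : Glob.{u}) : Type u where
  app : ∀ n : ℕ, X.cell n → Y.cell n
  app_src : ∀ {n : ℕ} (x : X.cell (n + 1)), app n (X.src x) = Y.src (app (n + 1) x)
  app_tgt : ∀ {n : ℕ} (x : X.cell (n + 1)), app n (X.tgt x) = Y.tgt (app (n + 1) x)

instance : Category.{u} Glob.{u} where
  Hom X Y := Hom X Y
  id X := { app := fun _ x => x, app_src := fun _ => rfl, app_tgt := fun _ => rfl }
  comp f g :=
    { app := fun n x => g.app n (f.app n x)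
      app_src := fun x => by rw [f.app_src, g.app_src]
      app_tgt := fun x => by rw [f.app_tgt, g.app_tgt] }

@[ext]
theorem hom_ext {X Y : Glob.{u}} {f g : X ⟶ Y} (h : ∀ n x, Hom.app f n x = Hom.app g n x) :
    f = g :=
  Hom.ext (funext fun n => funext fun x => h n x)

@[simp]
theorem id_app (X : Glob.{u}) (n : ℕ) (x : X.cell n) : Hom.app (𝟙 X) n x = x := rfl

@[simp]
theorem comp_app {X Y Z : Glob.{u}} (f : X ⟶ Y) (g : Y ⟶ Z) (n : ℕ) (x : X.cell n) :
    Hom.app (f ≫ g) n x = Hom.app g n (Hom.app f n x) := rfl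

/-- Two `n`-cells are parallel when they have common source and target (no condition on
`0`-cells). -/
def Parallel (X : Glob.{u}) : ∀ {n : ℕ}, X.cell n → X.cell n → Prop
  | 0, _, _ => True
  | _ + 1, a, b => X.src a = X.src b ∧ X.tgt a = X.tgt b

theorem parallel_src_tgt (X : Glob.{u}) :
    ∀ {n : ℕ} (x : X.cell (n + 1)), X.Parallel (X.src x) (X.tgt x)
  | 0, _ => trivial
  | _ + 1, x => ⟨X.src_src x, X.tgt_src x⟩

theorem Parallel.map {X Y : Glob.{u}} (f : X ⟶ Y) :
    ∀ {n : ℕ} {a b : X.cell n}, X.Parallel a b → Y.Parallel (Hom.app f n a) (Hom.app f n b)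
  | 0, _, _, _ => trivial
  | _ + 1, _, _, h => ⟨by rw [← f.app_src, ← f.app_src, h.1], by rw [← f.app_tgt, ← f.app_tgt, h.2]⟩

end Glob

/-! ## Batanin trees and their positions -/

/-- Batanin trees: rooted planar trees. -/
inductive Bat : Type
  | br : List Bat → Bat

mutual
/-- The dimension (height) of a Batanin tree. -/
def Bat.dim : Bat → ℕ
  | .br L => Bat.dimList L
/-- The dimension of `br L`: it is `0` for the empty list and
`max (dim B + 1) (dim (br L))` for the list `B :: L`. -/
def Bat.dimList : List Bat → ℕ
  | [] => 0
  | B :: L => max (Bat.dim B + 1) (Bat.dimList L)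
end

/-- The positions of dimension `n` of a Batanin tree (in an arbitrary universe). -/
inductive Pos : Bat → ℕ → Type u
  | here (B : Bat) : Pos B 0
  | inr {B : Bat} {L : List Bat} {n : ℕ} (p : Pos (.br L) n) : Pos (.br (B :: L)) n
  | inl {B : Bat} {L : List Bat} {n : ℕ} (q : Pos B n) : Pos (.br (B :: L)) (n + 1)

namespace Pos

def src : ∀ {B : Bat} {n : ℕ}, Pos.{u} B (n + 1) → Pos.{u} B n
  | _, _, .inr q => .inr (src q)
  | _, 0, .inl _ => .here _
  | _, _ + 1, .inl p => .inl (src p)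

def tgt : ∀ {B : Bat} {n : ℕ}, Pos.{u} B (n + 1) → Pos.{u} B n
  | _, _, .inr q => .inr (tgt q)
  | _, 0, .inl _ => .inr (.here _)
  | _, _ + 1, .inl p => .inl (tgt p)

theorem src_src : ∀ {B : Bat} {n : ℕ} (p : Pos.{u} B (n + 2)), src (src p) = src (tgt p)
  | _, _, .inr q => by simp only [src, tgt, src_src q]
  | _, 0, .inl _ => by simp only [src, tgt]
  | _, _ + 1, .inl p => by simp only [src, tgt, src_src p]

theorem tgt_src : ∀ {B : Bat} {n : ℕ} (p : Pos.{u} B (n + 2)), tgt (src p) = tgt (tgt p)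
  | _, _, .inr q => by simp only [src, tgt, tgt_src q]
  | _, 0, .inl _ => by simp only [src, tgt]
  | _, _ + 1, .inl p => by simp only [src, tgt, tgt_src p]

/-- Source boundary positions: those that are not the target of another position. -/
def srcBdry (B : Bat) (n : ℕ) : Set (Pos.{u} B n) := {p | ¬ ∃ q : Pos.{u} B (n + 1), tgt q = p}

/-- Target boundary positions: those that are not the source of another position. -/
def tgtBdry (B : Bat) (n : ℕ) : Set (Pos.{u} B n) := {p | ¬ ∃ q : Pos.{u} B (n + 1), src q = p}

end Pos

/-- The globular set of positions of a Batanin tree. -/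
def posGlob (B : Bat) : Glob.{u} where
  cell n := Pos.{u} B n
  src := Pos.src
  tgt := Pos.tgt
  src_src := Pos.src_src
  tgt_src := Pos.tgt_src

/-! ## Finite-dimensional computads

The categories of `n`-computads are built by recursion on `n`. The structure `Level n` only
records the type of the data that the recursion carries from one dimension to the next, together
with the laws needed to make sense of the next step; the actual data are `levelZero`, `levelSucc`
and `level` below. -/

/-- The shape of the data constructed in dimension `n`. -/
structure Level (n : ℕ) : Type (u + 2) where
  /-- The `n`-computads. -/
  Comp : Type (u + 1)
  /-- The category of `n`-computads and `n`-homomorphisms. -/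
  cat : Category.{u} Comp
  /-- The functor of `n`-cells. -/
  Cell : Comp → Type u
  cellMap : ∀ {C D : Comp}, (C ⟶ D) → Cell C → Cell D
  cellMap_id : ∀ (C : Comp) (c : Cell C), cellMap (𝟙 C) c = c
  cellMap_comp : ∀ {C D E : Comp} (σ : C ⟶ D) (τ : D ⟶ E) (c : Cell C),
    cellMap (σ ≫ τ) c = cellMap τ (cellMap σ c)
  /-- The functor of `n`-spheres. -/
  Sph : Comp → Type u
  sphMap : ∀ {C D : Comp}, (C ⟶ D) → Sph C → Sph D
  sphMap_id : ∀ (C : Comp) (s : Sph C), sphMap (𝟙 C) s = s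
  sphMap_comp : ∀ {C D E : Comp} (σ : C ⟶ D) (τ : D ⟶ E) (s : Sph C),
    sphMap (σ ≫ τ) s = sphMap τ (sphMap σ s)
  /-- The two cells of a sphere. -/
  pr₁ : ∀ {C : Comp}, Sph C → Cell C
  pr₂ : ∀ {C : Comp}, Sph C → Cell C
  pr₁_map : ∀ {C D : Comp} (σ : C ⟶ D) (s : Sph C), pr₁ (sphMap σ s) = cellMap σ (pr₁ s)
  pr₂_map : ∀ {C D : Comp} (σ : C ⟶ D) (s : Sph C), pr₂ (sphMap σ s) = cellMap σ (pr₂ s)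
  sph_ext : ∀ {C : Comp} {s t : Sph C}, pr₁ s = pr₁ t → pr₂ s = pr₂ t → s = t
  /-- The free `n`-computad on a globular set. -/
  Free : Glob.{u} ⥤ Comp
  /-- An `n`-cell of `X` seen as a generator cell of the free `n`-computad on `X`. -/
  gen : ∀ (X : Glob.{u}), X.cell n → Cell (Free.obj X)
  gen_map : ∀ {X Y : Glob.{u}} (f : X ⟶ Y) (x : X.cell n),
    cellMap (Free.map f) (gen X x) = gen Y (Glob.Hom.app f n x)
  /-- The `n`-sphere of the free `n`-computad on `X` given by two parallel `n`-cells of `X`. -/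
  posSph : ∀ (X : Glob.{u}) (a b : X.cell n), X.Parallel a b → Sph (Free.obj X)
  pr₁_posSph : ∀ (X : Glob.{u}) (a b : X.cell n) (h : X.Parallel a b),
    pr₁ (posSph X a b h) = gen X a
  pr₂_posSph : ∀ (X : Glob.{u}) (a b : X.cell n) (h : X.Parallel a b),
    pr₂ (posSph X a b h) = gen X b
  /-- The full `n`-spheres of a Batanin tree. -/
  Full : ∀ B : Bat, Sph (Free.obj (posGlob B)) → Prop

attribute [instance] Level.cat

/-- The base case: `0`-computads are sets, their `0`-cells are their elements, and their
`0`-spheres are pairs of elements. -/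
def levelZero : Level.{u} 0 where
  Comp := Type u
  cat := inferInstance
  Cell C := C
  cellMap σ c := σ c
  cellMap_id _ _ := rfl
  cellMap_comp _ _ _ := rfl
  Sph C := C × C
  sphMap σ s := (σ s.1, σ s.2)
  sphMap_id _ _ := rfl
  sphMap_comp _ _ _ := rfl
  pr₁ s := s.1
  pr₂ s := s.2
  pr₁_map _ _ := rfl
  pr₂_map _ _ := rfl
  sph_ext h₁ h₂ := Prod.ext h₁ h₂
  Free :=
    { obj := fun X => X.cell 0
      map := fun f => TypeCat.ofHom (Glob.Hom.app f 0)
      map_id := fun _ => rfl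
      map_comp := fun _ _ => rfl }
  gen _ x := x
  gen_map _ _ := rfl
  posSph _ a b _ := (a, b)
  pr₁_posSph _ _ _ _ := rfl
  pr₂_posSph _ _ _ _ := rfl
  Full B s := s.1 ∈ Pos.srcBdry.{u} B 0 ∧ s.2 ∈ Pos.tgtBdry.{u} B 0

/-! ### The inductive step -/

section Step

variable {n : ℕ} {P : Level.{u} n}

/-- The boundary sphere of an `(n+1)`-cell `x` of `X` in the free `n`-computad on `X`: the sphere of
the parallel pair `(src x, tgt x)`. -/
def Level.freeBdry (P : Level.{u} n) (X : Glob.{u}) (x : X.cell (n + 1)) : P.Sph (P.Free.obj X) :=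
  P.posSph X (X.src x) (X.tgt x) (X.parallel_src_tgt x)

theorem Level.sphMap_posSph (P : Level.{u} n) {X Y : Glob.{u}} (f : X ⟶ Y) (a b : X.cell n)
    (h : X.Parallel a b) :
    P.sphMap (P.Free.map f) (P.posSph X a b h) = P.posSph Y _ _ (h.map f) :=
  P.sph_ext (by rw [P.pr₁_map, P.pr₁_posSph, P.pr₁_posSph, P.gen_map])
    (by rw [P.pr₂_map, P.pr₂_posSph, P.pr₂_posSph, P.gen_map])

theorem Level.posSph_congr (P : Level.{u} n) {X : Glob.{u}} {a b a' b' : X.cell n}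
    (h : X.Parallel a b) (ha : a = a') (hb : b = b') :
    P.posSph X a b h = P.posSph X a' b' (ha ▸ hb ▸ h) := by
  subst ha hb; rfl

theorem Level.sphMap_freeBdry (P : Level.{u} n) {X Y : Glob.{u}} (f : X ⟶ Y) (x : X.cell (n + 1)) :
    P.sphMap (P.Free.map f) (P.freeBdry X x) = P.freeBdry Y (Glob.Hom.app f (n + 1) x) := by
  unfold Level.freeBdry
  rw [P.sphMap_posSph]
  exact P.posSph_congr _ (f.app_src x) (f.app_tgt x)

theorem Level.sphMap_freeBdry_eq (P : Level.{u} n) {X : Glob.{u}} {D : P.Comp}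
    (ε : P.Free.obj X ⟶ D) (x : X.cell (n + 1)) (s : P.Sph D)
    (h₁ : P.cellMap ε (P.gen X (X.src x)) = P.pr₁ s)
    (h₂ : P.cellMap ε (P.gen X (X.tgt x)) = P.pr₂ s) : P.sphMap ε (P.freeBdry X x) = s :=
  P.sph_ext (by rw [P.pr₁_map, ← h₁, Level.freeBdry, P.pr₁_posSph])
    (by rw [P.pr₂_map, ← h₂, Level.freeBdry, P.pr₂_posSph])

/-- An `(n+1)`-computad: an `n`-computad, a set of generators, and a sphere for each generator. -/
structure CompSucc (P : Level.{u} n) : Type (u + 1) where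
  base : P.Comp
  V : Type u
  φ : V → P.Sph base

/-- The data of the free `(n+1)`-computad on a globular set. -/
def freeObj (P : Level.{u} n) (X : Glob.{u}) : CompSucc P where
  base := P.Free.obj X
  V := X.cell (n + 1)
  φ := P.freeBdry X

/-- Expressions for `(n+1)`-cells: generators and coherences `coh B A τ`, where the
homomorphism `τ` consists of an `n`-homomorphism and a function `τV` from the `(n+1)`-positions of `B`
to expressions. The boundary condition on `τV` is imposed in `Expr.Valid`. -/
inductive Expr (C : CompSucc P) : Type u
  | var (v : C.V) : Expr C
  | coh (B : Bat) (hB : B.dim ≤ n + 1) (A : P.Sph (P.Free.obj (posGlob.{u} B))) (hA : P.Full B A)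
      (τ : P.Free.obj (posGlob.{u} B) ⟶ C.base) (τV : Pos.{u} B (n + 1) → Expr C) : Expr C

namespace Expr

/-- The boundary sphere of a cell expression. -/
def ty {C : CompSucc P} : Expr C → P.Sph C.base
  | var v => C.φ v
  | coh _ _ A _ τ _ => P.sphMap τ A

/-- A cell expression is valid when, hereditarily, the pairs `(τ, τV)` that occur in its coherences
are homomorphisms of computads. -/
def Valid {C : CompSucc P} : Expr C → Prop
  | var _ => True
  | coh B _ _ _ τ τV => ∀ p : Pos.{u} B (n + 1), (τV p).Valid ∧
      (τV p).ty = P.sphMap τ (P.freeBdry (posGlob.{u} B) p)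

end Expr

/-- The `(n+1)`-cells of an `(n+1)`-computad. -/
def CellSucc (C : CompSucc P) : Type u := {c : Expr C // c.Valid}

namespace CellSucc

/-- The boundary of an `(n+1)`-cell. -/
def ty {C : CompSucc P} (c : CellSucc C) : P.Sph C.base := c.1.ty

/-- The generator cells. -/
def var {C : CompSucc P} (v : C.V) : CellSucc C := ⟨.var v, trivial⟩

end CellSucc

/-- The `(n+1)`-homomorphisms `D ⟶ C`. -/
@[ext]
structure HomSucc (D C : CompSucc P) : Type u where
  base : D.base ⟶ C.base
  onV : D.V → CellSucc C
  comm : ∀ v : D.V, (onV v).ty = P.sphMap base (D.φ v)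

/-- The coherence cells, formed from a homomorphism out of the free computad on a tree. -/
def CellSucc.coh {C : CompSucc P} (B : Bat) (hB : B.dim ≤ n + 1)
    (A : P.Sph (P.Free.obj (posGlob.{u} B))) (hA : P.Full B A)
    (τ : HomSucc (freeObj P (posGlob.{u} B)) C) : CellSucc C :=
  ⟨.coh B hB A hA τ.base fun p => (τ.onV p).1, fun p => ⟨(τ.onV p).2, τ.comm p⟩⟩

/-- Cells are inductively generated by generators and coherences. -/
theorem CellSucc.induction {C : CompSucc P} {motive : CellSucc C → Prop}
    (var : ∀ v : C.V, motive (CellSucc.var v))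
    (coh : ∀ (B : Bat) (hB : B.dim ≤ n + 1) (A : P.Sph (P.Free.obj (posGlob.{u} B)))
      (hA : P.Full B A) (τ : HomSucc (freeObj P (posGlob.{u} B)) C),
      (∀ p, motive (τ.onV p)) → motive (CellSucc.coh B hB A hA τ))
    (c : CellSucc C) : motive c := by
  obtain ⟨c, hc⟩ := c
  induction c with
  | var v => exact var v
  | coh B hB A hA τ τV ih =>
    exact coh B hB A hA ⟨τ, fun p => ⟨τV p, (hc p).1⟩, fun p => (hc p).2⟩
      fun p => ih p (hc p).1

/-- The action of a homomorphism on cell expressions. -/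
def Expr.map {C D : CompSucc P} (σ : HomSucc C D) : Expr C → Expr D
  | .var v => (σ.onV v).1
  | .coh B hB A hA τ τV => .coh B hB A hA (τ ≫ σ.base) fun p => (τV p).map σ

theorem Expr.ty_map {C D : CompSucc P} (σ : HomSucc C D) (c : Expr C) :
    (c.map σ).ty = P.sphMap σ.base c.ty := by
  cases c with
  | var v => exact σ.comm v
  | coh B hB A hA τ τV => exact P.sphMap_comp _ _ _

theorem Expr.Valid.map {C D : CompSucc P} (σ : HomSucc C D) (c : Expr C) (hc : c.Valid) :
    (c.map σ).Valid := by
  induction c with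
  | var v => exact (σ.onV v).2
  | coh B hB A hA τ τV ih =>
    intro p
    exact ⟨ih p (hc p).1, by rw [Expr.ty_map, (hc p).2, P.sphMap_comp]⟩

/-- The action of a homomorphism on cells: `var v ↦ σ_V v` and `coh B A τ ↦ coh B A (τ ≫ σ)`. -/
def CellSucc.map {C D : CompSucc P} (σ : HomSucc C D) (c : CellSucc C) : CellSucc D :=
  ⟨c.1.map σ, c.2.map σ⟩

theorem CellSucc.ty_map {C D : CompSucc P} (σ : HomSucc C D) (c : CellSucc C) :
    (c.map σ).ty = P.sphMap σ.base c.ty :=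
  Expr.ty_map σ c.1

namespace HomSucc

/-- The identity homomorphism. -/
def id (C : CompSucc P) : HomSucc C C where
  base := 𝟙 C.base
  onV := CellSucc.var
  comm _ := (P.sphMap_id _ _).symm

/-- Composition of homomorphisms. -/
def comp {C D E : CompSucc P} (σ : HomSucc C D) (τ : HomSucc D E) : HomSucc C E where
  base := σ.base ≫ τ.base
  onV v := (σ.onV v).map τ
  comm v := by rw [CellSucc.ty_map, σ.comm, P.sphMap_comp]

end HomSucc

theorem Expr.map_id {C : CompSucc P} (c : Expr C) : c.map (HomSucc.id C) = c := by
  induction c with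
  | var v => rfl
  | coh B hB A hA τ τV ih =>
    have h : τ ≫ (HomSucc.id C).base = τ := Category.comp_id τ
    simp only [Expr.map, h, ih]

theorem Expr.map_comp {C D E : CompSucc P} (σ : HomSucc C D) (τ : HomSucc D E) (c : Expr C) :
    c.map (σ.comp τ) = (c.map σ).map τ := by
  induction c with
  | var v => rfl
  | coh B hB A hA ρ ρV ih =>
    have h : ρ ≫ (σ.comp τ).base = (ρ ≫ σ.base) ≫ τ.base := (Category.assoc _ _ _).symm
    simp only [Expr.map, h, ih]

theorem CellSucc.map_id {C : CompSucc P} (c : CellSucc C) : c.map (HomSucc.id C) = c :=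
  Subtype.ext (Expr.map_id c.1)

theorem CellSucc.map_comp {C D E : CompSucc P} (σ : HomSucc C D) (τ : HomSucc D E)
    (c : CellSucc C) : c.map (σ.comp τ) = (c.map σ).map τ :=
  Subtype.ext (Expr.map_comp σ τ c.1)

/-- The category of `(n+1)`-computads. -/
instance catSucc (P : Level.{u} n) : Category.{u} (CompSucc P) where
  Hom C D := HomSucc C D
  id C := HomSucc.id C
  comp σ τ := σ.comp τ
  id_comp _ := HomSucc.ext (Category.id_comp _) rfl
  comp_id _ := HomSucc.ext (Category.comp_id _) (funext fun _ => CellSucc.map_id _)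
  assoc σ τ ρ :=
    HomSucc.ext (Category.assoc _ _ _) (funext fun v => (CellSucc.map_comp τ ρ (σ.onV v)).symm)

/-- The `(n+1)`-spheres: an `n`-sphere and two `(n+1)`-cells with that boundary. -/
@[ext]
structure SphSucc (C : CompSucc P) : Type u where
  bdry : P.Sph C.base
  fst : CellSucc C
  snd : CellSucc C
  ty_fst : fst.ty = bdry
  ty_snd : snd.ty = bdry

/-- The action of a homomorphism on spheres. -/
def SphSucc.map {C D : CompSucc P} (σ : HomSucc C D) (s : SphSucc C) : SphSucc D where
  bdry := P.sphMap σ.base s.bdry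
  fst := s.fst.map σ
  snd := s.snd.map σ
  ty_fst := by rw [CellSucc.ty_map, s.ty_fst]
  ty_snd := by rw [CellSucc.ty_map, s.ty_snd]

/-- The free `(n+1)`-computad functor. -/
def freeSucc (P : Level.{u} n) : Glob.{u} ⥤ CompSucc P where
  obj X := freeObj P X
  map {X Y} f := HomSucc.mk (D := freeObj P X) (C := freeObj P Y) (P.Free.map f)
    (fun x => CellSucc.var (C := freeObj P Y) (Glob.Hom.app f (n + 1) x))
    (fun x => (P.sphMap_freeBdry f x).symm)
  map_id X := HomSucc.ext (P.Free.map_id X) rfl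
  map_comp f g := HomSucc.ext (P.Free.map_comp f g) rfl

/-- The support of a cell expression: the generators of dimension `n+1` that appear in it. -/
def Expr.supp {C : CompSucc P} : Expr C → Set C.V
  | .var v => {v}
  | .coh B _ _ _ _ τV => ⋃ p : Pos.{u} B (n + 1), (τV p).supp

/-- The support of an `(n+1)`-cell. -/
def CellSucc.supp {C : CompSucc P} (c : CellSucc C) : Set C.V := c.1.supp

/-- The sphere of the free computad on `X` given by two parallel `(n+1)`-cells of `X`. -/
def posSphSucc (P : Level.{u} n) (X : Glob.{u}) (a b : X.cell (n + 1)) (h : X.Parallel a b) :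
    SphSucc (freeObj P X) where
  bdry := P.freeBdry X a
  fst := CellSucc.var (C := freeObj P X) a
  snd := CellSucc.var (C := freeObj P X) b
  ty_fst := rfl
  ty_snd := P.posSph_congr _ h.1.symm h.2.symm

/-- The inductive step of the construction of finite-dimensional computads. -/
def levelSucc (P : Level.{u} n) : Level.{u} (n + 1) where
  Comp := CompSucc P
  cat := catSucc P
  Cell C := CellSucc C
  cellMap σ c := CellSucc.map σ c
  cellMap_id _ c := CellSucc.map_id c
  cellMap_comp σ τ c := CellSucc.map_comp σ τ c
  Sph C := SphSucc C
  sphMap σ s := SphSucc.map σ s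
  sphMap_id _ _ := SphSucc.ext (P.sphMap_id _ _) (CellSucc.map_id _) (CellSucc.map_id _)
  sphMap_comp _ _ _ :=
    SphSucc.ext (P.sphMap_comp _ _ _) (CellSucc.map_comp _ _ _) (CellSucc.map_comp _ _ _)
  pr₁ s := s.fst
  pr₂ s := s.snd
  pr₁_map _ _ := rfl
  pr₂_map _ _ := rfl
  sph_ext {_ s t} h₁ h₂ :=
    SphSucc.ext (s.ty_fst.symm.trans ((congrArg CellSucc.ty h₁).trans t.ty_fst)) h₁ h₂
  Free := freeSucc P
  gen X x := CellSucc.var (C := freeObj P X) x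
  gen_map _ _ := rfl
  posSph X a b h := posSphSucc P X a b h
  pr₁_posSph _ _ _ _ := rfl
  pr₂_posSph _ _ _ _ := rfl
  Full B s := s.fst.supp = Pos.srcBdry.{u} B (n + 1) ∧ s.snd.supp = Pos.tgtBdry.{u} B (n + 1) ∧
    P.Full B s.bdry

/-- The forgetful functor from `(n+1)`-computads to `n`-computads. -/
def forgetSucc (P : Level.{u} n) : CompSucc P ⥤ P.Comp where
  obj C := C.base
  map σ := HomSucc.base σ
  map_id _ := rfl
  map_comp _ _ := rfl

end Step

/-- The data in each dimension. -/
def level : ∀ n : ℕ, Level.{u} n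
  | 0 => levelZero
  | n + 1 => levelSucc (level n)

/-- The category of `n`-computads. -/
abbrev CompN (n : ℕ) : Type (u + 1) := (level.{u} n).Comp

/-- The forgetful functor from `(n+1)`-computads to `n`-computads. -/
def forgetN (n : ℕ) : CompN.{u} (n + 1) ⥤ CompN.{u} n := forgetSucc (level n)

/-- The boundary sphere of an `(n+1)`-cell. -/
def tyN {n : ℕ} {C : CompN.{u} (n + 1)} (c : (level (n + 1)).Cell C) :
    (level n).Sph ((forgetN n).obj C) :=
  CellSucc.ty (P := level n) c

theorem tyN_map {n : ℕ} {C D : CompN.{u} (n + 1)} (σ : C ⟶ D) (c : (level (n + 1)).Cell C) :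
    tyN ((level (n + 1)).cellMap σ c) = (level n).sphMap ((forgetN n).map σ) (tyN c) :=
  CellSucc.ty_map (P := level n) σ c

theorem tyN_pr₁ {n : ℕ} {C : CompN.{u} (n + 1)} (s : (level (n + 1)).Sph C) :
    tyN ((level (n + 1)).pr₁ s) = tyN ((level (n + 1)).pr₂ s) :=
  (SphSucc.ty_fst (P := level n) s).trans (SphSucc.ty_snd (P := level n) s).symm

/-! ## Computads -/

/-- Objects of the limit of the categories of `n`-computads along the forgetful functors. -/
structure Computad : Type (u + 1) where
  trunc : ∀ n : ℕ, CompN.{u} n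
  forget_trunc : ∀ n : ℕ, (forgetN n).obj (trunc (n + 1)) = trunc n

namespace Computad

/-- Homomorphisms of computads: sequences of `n`-homomorphisms with `u_{n+1} σ_{n+1} = σ_n`. The
canonical morphisms `eqToHom` only account for the equalities of objects `u_{n+1} C_{n+1} = C_n`. -/
@[ext]
structure Hom (C D : Computad.{u}) : Type u where
  app : ∀ n : ℕ, C.trunc n ⟶ D.trunc n
  comm : ∀ n : ℕ, (forgetN n).map (app (n + 1)) ≫ eqToHom (D.forget_trunc n) =
    eqToHom (C.forget_trunc n) ≫ app n

instance : Category.{u} Computad.{u} where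
  Hom C D := Hom C D
  id C := { app := fun n => 𝟙 (C.trunc n), comm := fun n => by simp }
  comp σ τ :=
    { app := fun n => σ.app n ≫ τ.app n
      comm := fun n => by
        rw [Functor.map_comp, Category.assoc, τ.comm, ← Category.assoc, σ.comm, Category.assoc] }
  id_comp σ := Hom.ext (funext fun _ => Category.id_comp _)
  comp_id σ := Hom.ext (funext fun _ => Category.comp_id _)
  assoc σ τ ρ := Hom.ext (funext fun _ => Category.assoc _ _ _)

@[ext]
theorem hom_ext {C D : Computad.{u}} {σ τ : C ⟶ D} (h : ∀ n, Hom.app σ n = Hom.app τ n) : σ = τ :=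
  Hom.ext (funext h)

@[simp]
theorem id_app (C : Computad.{u}) (n : ℕ) : Hom.app (𝟙 C) n = 𝟙 (C.trunc n) := rfl

@[simp]
theorem comp_app {C D E : Computad.{u}} (σ : C ⟶ D) (τ : D ⟶ E) (n : ℕ) :
    Hom.app (σ ≫ τ) n = Hom.app σ n ≫ Hom.app τ n := rfl

/-- The boundary sphere of an `(n+1)`-cell of a computad. -/
def bdry (C : Computad.{u}) {n : ℕ} (c : (level (n + 1)).Cell (C.trunc (n + 1))) :
    (level n).Sph (C.trunc n) :=
  (level n).sphMap (eqToHom (C.forget_trunc n)) (tyN c)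

theorem bdry_map {C D : Computad.{u}} (σ : C ⟶ D) {n : ℕ}
    (c : (level (n + 1)).Cell (C.trunc (n + 1))) :
    D.bdry ((level (n + 1)).cellMap (Hom.app σ (n + 1)) c) =
      (level n).sphMap (Hom.app σ n) (C.bdry c) := by
  unfold bdry
  rw [tyN_map, ← Level.sphMap_comp, ← Level.sphMap_comp, σ.comm]

theorem bdry_pr (C : Computad.{u}) {n : ℕ} (s : (level (n + 1)).Sph (C.trunc (n + 1))) :
    C.bdry ((level (n + 1)).pr₁ s) = C.bdry ((level (n + 1)).pr₂ s) :=
  congrArg ((level n).sphMap (eqToHom (C.forget_trunc n))) (tyN_pr₁ s)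

theorem bdry_map_pr₁ {C D : Computad.{u}} (σ : C ⟶ D) {n : ℕ}
    (c : (level (n + 1)).Cell (C.trunc (n + 1))) :
    (level n).cellMap (Hom.app σ n) ((level n).pr₁ (C.bdry c)) =
      (level n).pr₁ (D.bdry ((level (n + 1)).cellMap (Hom.app σ (n + 1)) c)) := by
  rw [bdry_map, Level.pr₁_map]

theorem bdry_map_pr₂ {C D : Computad.{u}} (σ : C ⟶ D) {n : ℕ}
    (c : (level (n + 1)).Cell (C.trunc (n + 1))) :
    (level n).cellMap (Hom.app σ n) ((level n).pr₂ (C.bdry c)) =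
      (level n).pr₂ (D.bdry ((level (n + 1)).cellMap (Hom.app σ (n + 1)) c)) := by
  rw [bdry_map, Level.pr₂_map]

theorem tyN_eq (C : Computad.{u}) {n : ℕ} (c : (level (n + 1)).Cell (C.trunc (n + 1))) :
    tyN c = (level n).sphMap (eqToHom (C.forget_trunc n).symm) (C.bdry c) := by
  rw [bdry, ← Level.sphMap_comp, eqToHom_trans, eqToHom_refl, Level.sphMap_id]

end Computad

/-! ## The free computad adjunction -/

/-- The globular set of cells of a computad; source and target are the two components of the
boundary sphere. -/
def cellGlob (C : Computad.{u}) : Glob.{u} where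
  cell n := (level n).Cell (C.trunc n)
  src {n} c := (level n).pr₁ (C.bdry c)
  tgt {n} c := (level n).pr₂ (C.bdry c)
  src_src _ := congrArg _ (C.bdry_pr _)
  tgt_src _ := congrArg _ (C.bdry_pr _)

/-- The functor of cells. -/
def Cell : Computad.{u} ⥤ Glob.{u} where
  obj C := cellGlob C
  map {C D} σ := Glob.Hom.mk (X := cellGlob C) (Y := cellGlob D)
    (fun n c => (level n).cellMap (Computad.Hom.app σ n) c)
    (fun c => Computad.bdry_map_pr₁ σ c) (fun c => Computad.bdry_map_pr₂ σ c)
  map_id _ := Glob.hom_ext fun n c => (level n).cellMap_id _ c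
  map_comp _ _ := Glob.hom_ext fun n c => (level n).cellMap_comp _ _ c

/-- The free computad functor. -/
def Free : Glob.{u} ⥤ Computad.{u} where
  obj X := { trunc := fun n => (level n).Free.obj X, forget_trunc := fun _ => rfl }
  map f :=
    { app := fun n => (level n).Free.map f
      comm := fun n => (Category.comp_id _).trans (Category.id_comp _).symm }
  map_id X := Computad.hom_ext fun n => (level n).Free.map_id X
  map_comp f g := Computad.hom_ext fun n => (level n).Free.map_comp f g

theorem Free_bdry_gen (X : Glob.{u}) {n : ℕ} (x : X.cell (n + 1)) :
    (Free.obj X).bdry ((level (n + 1)).gen X x) = (level n).freeBdry X x :=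
  (level n).sphMap_id _ _

/-- The component of the unit at a globular set: cells are sent to generators. -/
def unitApp (X : Glob.{u}) : X ⟶ Cell.obj (Free.obj X) :=
  Glob.Hom.mk (X := X) (Y := Cell.obj (Free.obj X)) (fun n x => (level n).gen X x)
    (fun {n} x => (((congrArg (level n).pr₁ (Free_bdry_gen X x)).trans
      ((level n).pr₁_posSph _ _ _ _)).symm))
    (fun {n} x => (((congrArg (level n).pr₂ (Free_bdry_gen X x)).trans
      ((level n).pr₂_posSph _ _ _ _)).symm))

/-- The components `ε_n` of the counit at a computad, given by `ε_0 = id` and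
`ε_{n+1} = (ε_n, id)`. The subtype records that `ε_n` sends the generator of a cell to that cell,
which is needed for the next step. -/
def counitAux (C : Computad.{u}) : ∀ n : ℕ,
    {ε : (level n).Free.obj (Cell.obj C) ⟶ C.trunc n //
      ∀ c : (level n).Cell (C.trunc n), (level n).cellMap ε ((level n).gen (Cell.obj C) c) = c}
  | 0 => ⟨𝟙 (C.trunc 0), fun _ => rfl⟩
  | n + 1 =>
    ⟨HomSucc.mk (P := level n) (D := freeObj (level n) (Cell.obj C)) (C := C.trunc (n + 1))
      ((counitAux C n).1 ≫ eqToHom (C.forget_trunc n).symm) (fun c => c) (fun c =>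
        (C.tyN_eq c).trans ((congrArg _ ((level n).sphMap_freeBdry_eq (X := Cell.obj C)
          (counitAux C n).1 c (C.bdry c) ((counitAux C n).2 _) ((counitAux C n).2 _)).symm).trans
          ((level n).sphMap_comp _ _ _).symm)),
      fun _ => rfl⟩

theorem comp_eqToHom_cancel {n : ℕ} {X C D : CompN.{u} n} {f g : X ⟶ C} (h : C = D)
    (w : f ≫ eqToHom h = g ≫ eqToHom h) : f = g := by
  subst h; simpa using w

theorem comp_eqToHom_symm_comp {n : ℕ} {X C D : CompN.{u} n} (ε : X ⟶ C) (h : D = C) :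
    (ε ≫ eqToHom h.symm) ≫ eqToHom h = 𝟙 X ≫ ε := by
  subst h; simp

/-- The component of the counit at a computad. -/
def counitApp (C : Computad.{u}) : Free.obj (Cell.obj C) ⟶ C :=
  Computad.Hom.mk (C := Free.obj (Cell.obj C)) (D := C) (fun n => (counitAux C n).1) (fun n =>
    comp_eqToHom_symm_comp (counitAux C n).1 (C.forget_trunc n))

/-- A homomorphism out of a free computad is determined by its values on generators. -/
theorem free_hom_ext {X : Glob.{u}} {D : Computad.{u}} {σ τ : Free.obj X ⟶ D}
    (h : ∀ n (x : X.cell n), (level n).cellMap (Computad.Hom.app σ n) ((level n).gen X x) =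
      (level n).cellMap (Computad.Hom.app τ n) ((level n).gen X x)) : σ = τ := by
  refine Computad.hom_ext fun n => ?_
  induction n with
  | zero => exact ConcreteCategory.hom_ext (C := Type u) _ _ (h 0)
  | succ n ih =>
    refine HomSucc.ext (P := level n) ?_ (funext (h (n + 1)))
    have h₁ := Computad.Hom.comm σ n
    rw [ih, ← Computad.Hom.comm τ n] at h₁
    exact comp_eqToHom_cancel (D.forget_trunc n) h₁

/-- The functor of cells is right adjoint to the free computad functor. -/
def freeCellAdj : Free.{u} ⊣ Cell.{u} :=
  Adjunction.mkOfUnitCounit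
    { unit :=
        { app := unitApp
          naturality := fun X Y f => Glob.hom_ext fun n x => ((level n).gen_map f x).symm }
      counit :=
        { app := counitApp
          naturality := fun C D σ => free_hom_ext fun n c => by
            refine ((level n).cellMap_comp _ _ _).trans (Eq.trans ?_
              ((level n).cellMap_comp _ _ _).symm)
            refine (congrArg _ ((level n).gen_map (Cell.map σ) c)).trans ?_
            exact ((counitAux D n).2 _).trans
              (congrArg ((level n).cellMap (Computad.Hom.app σ n)) ((counitAux C n).2 c)).symm }
      left_triangle := by
        ext X : 2
        refine free_hom_ext fun n x => ?_
        simp only [NatTrans.comp_app, Functor.whiskerRight_app, Functor.associator_hom_app,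
          Functor.whiskerLeft_app, Category.id_comp, NatTrans.id_app']
        refine ((level n).cellMap_comp _ _ _).trans (Eq.trans ?_ ((level n).cellMap_id _ _).symm)
        refine (congrArg _ ((level n).gen_map (unitApp X) x)).trans ?_
        exact (counitAux (Free.obj X) n).2 _
      right_triangle := by
        ext C : 2
        refine Glob.hom_ext fun n c => ?_
        simp only [NatTrans.comp_app, Functor.whiskerRight_app, Functor.associator_inv_app,
          Functor.whiskerLeft_app, Category.id_comp, NatTrans.id_app']
        exact (counitAux C n).2 c }

/-! ## Weak ω-categories -/

/-- The free weak `ω`-category monad on globular sets. -/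
def fcW : Monad Glob.{u} := freeCellAdj.toMonad

/-- The category of weak `ω`-categories and (strict) homomorphisms: the algebras of the monad. -/
abbrev OmegaCat : Type (u + 1) := fcW.{u}.Algebra

/-- The comparison functor from computads to `ω`-categories. -/
def Kw : Computad.{u} ⥤ OmegaCat.{u} := Monad.comparison freeCellAdj

/-- The comparison functor commutes with the right adjoints. -/
theorem Kw_comp_forget : Kw.{u} ⋙ fcW.forget = Cell := rfl

/-- The comparison functor commutes with the left adjoints. -/
theorem Free_comp_Kw : Free.{u} ⋙ Kw = fcW.free := Monad.left_comparison freeCellAdj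

end WeakOmega

namespace WeakOmega

/-! ## Positions of a tree -/

-- Faithfulness: a homomorphism of computads is recovered, dimension by dimension, from its values
-- on generators. Generators are cells, so its action on cells determines it (`trunc_hom_ext`).
--
-- Fullness: let `f` be the globular map underlying a strict functor, so that `f ∘ ε_C = ε_D ∘ Free
-- f` on cells of `Free (Cell C)`. The only possible preimage sends a generator `v` to `f (var v)`.
-- If the part of `σ` built so far acts on `n`-cells as `f` does, these values have the right
-- boundaries because `f` is globular (`Represents.bdry`), so `σ` extends to dimension `n + 1`. What
-- remains is that the extension agrees with `f` on coherences too.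
--
-- Since `dim B ≤ n + 1`, the globular set of positions of `B` is empty above dimension `n + 1`. A
-- homomorphism `τ` out of the free `(n+1)`-computad on it therefore has an adjoint transpose `t`,
-- and `τ = Free t ≫ ε_C` (`free_transpose_counit`). So `coh (B, A, τ)` is the evaluation under
-- `ε_C` of the formal cell `coh (B, A, Free t)`. Strictness gives `f (coh (B, A, τ)) = coh (B, A,
-- Free t ≫ Free f ≫ ε_D)`, and this is `coh (B, A, τ ≫ σ)`: the two homomorphisms agree on
-- top-dimensional positions by structural induction and below them by the inductive hypothesis on
-- dimension. This is `Represents.succ`.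

/-- Supplies the vanishing hypothesis of `transpose` for the pasting diagram of a tree. -/
theorem Pos.le_dim {B : Bat} {n : ℕ} (p : Pos.{u} B n) : n ≤ B.dim := by
  induction p with
  | here B => exact Nat.zero_le _
  | inr p ih =>
    simp only [Bat.dim, Bat.dimList] at ih ⊢
    exact ih.trans (le_max_right _ _)
  | inl q ih =>
    simp only [Bat.dim, Bat.dimList]
    exact (Nat.succ_le_succ ih).trans (le_max_left _ _)

/-! ## Restriction of homomorphisms to lower dimensions -/

namespace Computad

variable {C D : Computad.{u}}

/-- The `n`-homomorphism underlying an `(n+1)`-homomorphism between truncations of computads. -/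
def restrict {n : ℕ} (σ : C.trunc (n + 1) ⟶ D.trunc (n + 1)) : C.trunc n ⟶ D.trunc n :=
  eqToHom (C.forget_trunc n).symm ≫ (forgetN n).map σ ≫ eqToHom (D.forget_trunc n)

theorem forgetN_map_eq {n : ℕ} (σ : C.trunc (n + 1) ⟶ D.trunc (n + 1)) :
    (forgetN n).map σ =
      eqToHom (C.forget_trunc n) ≫ restrict σ ≫ eqToHom (D.forget_trunc n).symm := by
  simp [restrict]

theorem restrict_app (σ : C ⟶ D) (n : ℕ) : restrict (Hom.app σ (n + 1)) = Hom.app σ n := by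
  rw [restrict, σ.comm]
  simp

theorem restrict_comp {E : Computad.{u}} {n : ℕ} (σ : C.trunc (n + 1) ⟶ D.trunc (n + 1))
    (τ : D.trunc (n + 1) ⟶ E.trunc (n + 1)) : restrict (σ ≫ τ) = restrict σ ≫ restrict τ := by
  simp [restrict]

/-- Analogue of `bdry_map` for a homomorphism given only between two truncations, such as the `τ` of
a coherence cell, which does not come with components in every dimension. -/
theorem bdry_cellMap {n : ℕ} (σ : C.trunc (n + 1) ⟶ D.trunc (n + 1))
    (c : (level (n + 1)).Cell (C.trunc (n + 1))) :
    D.bdry ((level (n + 1)).cellMap σ c) = (level n).sphMap (restrict σ) (C.bdry c) := by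
  unfold bdry
  rw [tyN_map, ← Level.sphMap_comp, ← Level.sphMap_comp, restrict, eqToHom_trans_assoc,
    eqToHom_refl, Category.id_comp]

/-- An `(n+1)`-homomorphism is determined by its restriction and its values on generators. -/
theorem hom_succ_ext {n : ℕ} {σ τ : C.trunc (n + 1) ⟶ D.trunc (n + 1)}
    (h : restrict σ = restrict τ)
    (hV : ∀ v : CompSucc.V (P := level n) (C.trunc (n + 1)),
      HomSucc.onV (P := level n) σ v = HomSucc.onV (P := level n) τ v) : σ = τ := by
  refine HomSucc.ext (P := level n) ?_ (funext hV)
  have := (forgetN_map_eq σ).trans ((congrArg (fun ρ => eqToHom (C.forget_trunc n) ≫ ρ ≫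
    eqToHom (D.forget_trunc n).symm) h).trans (forgetN_map_eq τ).symm)
  exact this

/-- The `(n+1)`-homomorphism with given restriction and given values on generators. -/
def homSuccMk {n : ℕ} (σ : C.trunc n ⟶ D.trunc n)
    (s : CompSucc.V (P := level n) (C.trunc (n + 1)) → (level (n + 1)).Cell (D.trunc (n + 1)))
    (hs : ∀ v, D.bdry (s v) =
      (level n).sphMap σ (C.bdry (n := n) (CellSucc.var (P := level n) v))) :
    C.trunc (n + 1) ⟶ D.trunc (n + 1) :=
  HomSucc.mk (P := level n) (D := C.trunc (n + 1)) (C := D.trunc (n + 1))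
    (eqToHom (C.forget_trunc n) ≫ σ ≫ eqToHom (D.forget_trunc n).symm) s (fun v => by
      -- `tyN` and `bdry` differ by transport along `forget_trunc`; up to this transport, `hs` is
      -- the boundary condition of a homomorphism.
      refine (D.tyN_eq (s v)).trans ?_
      rw [hs v]
      refine (congrArg _ ((level n).sphMap_comp _ _ _).symm).trans ?_
      refine ((level n).sphMap_comp _ _ _).symm.trans ?_
      rw [Category.assoc]
      rfl)

theorem restrict_homSuccMk {n : ℕ} (σ : C.trunc n ⟶ D.trunc n)
    (s : CompSucc.V (P := level n) (C.trunc (n + 1)) → (level (n + 1)).Cell (D.trunc (n + 1)))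
    (hs) : restrict (homSuccMk σ s hs) = σ := by
  have h : (forgetN n).map (homSuccMk σ s hs) =
    eqToHom (C.forget_trunc n) ≫ σ ≫ eqToHom (D.forget_trunc n).symm := rfl
  rw [restrict, h]
  simp

/-- The `k`-homomorphism underlying an `m`-homomorphism, for `k ≤ m`. -/
def lower {k m : ℕ} (h : k ≤ m) : (C.trunc m ⟶ D.trunc m) → (C.trunc k ⟶ D.trunc k) :=
  Nat.leRec (motive := fun m _ => (C.trunc m ⟶ D.trunc m) → (C.trunc k ⟶ D.trunc k))
    (fun σ => σ) (fun _ _ r σ => r (restrict σ)) h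

theorem lower_self {m : ℕ} (σ : C.trunc m ⟶ D.trunc m) : lower le_rfl σ = σ := by
  unfold lower
  rw [Nat.leRec_self]

theorem lower_succ {k m : ℕ} (h : k ≤ m) (σ : C.trunc (m + 1) ⟶ D.trunc (m + 1)) :
    lower (h.trans (Nat.le_succ m)) σ = lower h (restrict σ) := by
  unfold lower
  rw [Nat.leRec_succ _ _ h]

/-- `lower` peels off dimensions from the top, whereas here one is removed at the bottom; hence the
induction on `m`. -/
theorem restrict_lower {k m : ℕ} (h : k + 1 ≤ m) (σ : C.trunc m ⟶ D.trunc m) :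
    restrict (lower h σ) = lower (Nat.le_of_succ_le h) σ := by
  induction m, h using Nat.le_induction with
  | base => rw [lower_self, lower_succ le_rfl, lower_self]
  | succ m h ih => rw [lower_succ h, ih, ← lower_succ]

/-- A homomorphism is determined by its action on cells. -/
theorem trunc_hom_ext : ∀ {n : ℕ} {σ τ : C ⟶ D}, (∀ k (c : (level k).Cell (C.trunc k)),
    (level k).cellMap (Hom.app σ k) c = (level k).cellMap (Hom.app τ k) c) →
    Hom.app σ n = Hom.app τ n
  | 0, _, _, h => ConcreteCategory.hom_ext (C := Type u) _ _ (h 0)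
  | n + 1, σ, τ, h => hom_succ_ext
      (by rw [restrict_app, restrict_app]; exact trunc_hom_ext h)
      (fun v => h (n + 1) (CellSucc.var (P := level n) v))

end Computad

open Computad

/-! ## Transposes of homomorphisms out of free computads -/

/-- The morphism of globular sets corresponding to a homomorphism of `m`-computads out of the free
`m`-computad on a globular set without cells of dimension above `m`. -/
def transpose {X : Glob.{u}} {C : Computad.{u}} {m : ℕ} (hX : ∀ k, X.cell k → k ≤ m)
    (τ : (Free.obj X).trunc m ⟶ C.trunc m) : X ⟶ Cell.obj C :=
  Glob.Hom.mk (X := X) (Y := Cell.obj C)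
    (fun k x => (level k).cellMap (lower (C := Free.obj X) (hX k x) τ) ((level k).gen X x))
    (fun {k} x => by
      refine Eq.trans ?_ (congrArg (level k).pr₁ (bdry_cellMap (C := Free.obj X) _ _)).symm
      rw [Level.pr₁_map, restrict_lower]
      -- Both sides are now values of the same `k`-homomorphism, and the unit is globular: the
      -- source of the generator of `x` is the generator of the source of `x`.
      exact congrArg _ (Glob.Hom.app_src (unitApp X) x))
    (fun {k} x => by
      refine Eq.trans ?_ (congrArg (level k).pr₂ (bdry_cellMap (C := Free.obj X) _ _)).symm
      rw [Level.pr₂_map, restrict_lower]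
      exact congrArg _ (Glob.Hom.app_tgt (unitApp X) x))

/-- `Free.map t` sends the generator of `x` to the generator of the cell `t x`, which the counit
evaluates to that cell. -/
theorem cellMap_free_counit {X : Glob.{u}} {C : Computad.{u}} (t : X ⟶ Cell.obj C) (k : ℕ)
    (x : X.cell k) :
    (level k).cellMap (Hom.app (Free.map t ≫ counitApp C) k) ((level k).gen X x) =
      Glob.Hom.app t k x := by
  refine ((level k).cellMap_comp _ _ _).trans ?_
  refine (congrArg _ ((level k).gen_map t x)).trans ?_
  exact (counitAux C k).2 _

/-- All dimensions up to `m` are treated together because equality of `(k+1)`-homomorphisms reduces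
to equality of their restrictions and of their values on generators. On generators both sides agree
by the definition of `transpose`. -/
theorem free_transpose_counit_lower {X : Glob.{u}} {C : Computad.{u}} {m : ℕ}
    (hX : ∀ k, X.cell k → k ≤ m) (τ : (Free.obj X).trunc m ⟶ C.trunc m) :
    ∀ {k : ℕ} (h : k ≤ m), Hom.app (Free.map (transpose hX τ) ≫ counitApp C) k = lower h τ
  | 0, _ => ConcreteCategory.hom_ext (C := Type u) _ _
      (fun x => cellMap_free_counit (transpose hX τ) 0 x)
  | k + 1, h => hom_succ_ext
      (by rw [restrict_app, restrict_lower]; exact free_transpose_counit_lower hX τ _)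
      (fun x => cellMap_free_counit (transpose hX τ) (k + 1) x)

theorem free_transpose_counit {X : Glob.{u}} {C : Computad.{u}} {m : ℕ}
    (hX : ∀ k, X.cell k → k ≤ m) (τ : (Free.obj X).trunc m ⟶ C.trunc m) :
    Hom.app (Free.map (transpose hX τ)) m ≫ Hom.app (counitApp C) m = τ :=
  (free_transpose_counit_lower hX τ le_rfl).trans (lower_self τ)

/-! ## Homomorphisms of computads from strict functors -/

section Lift

variable {C D : Computad.{u}} (f : Cell.obj C ⟶ Cell.obj D)

/-- A morphism between globular sets of cells that commutes with the evaluation maps. -/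
def IsStrict : Prop :=
  ∀ n (c : (level n).Cell ((Free.obj (Cell.obj C)).trunc n)),
    (level n).cellMap (Hom.app (counitApp D) n) ((level n).cellMap (Hom.app (Free.map f) n) c) =
      Glob.Hom.app f n ((level n).cellMap (Hom.app (counitApp C) n) c)

/-- `σ` acts on `n`-cells as `f`, and commutes with the counits. -/
structure Represents {n : ℕ} (σ : C.trunc n ⟶ D.trunc n) : Prop where
  cellMap_eq : ∀ c : (level n).Cell (C.trunc n), (level n).cellMap σ c = Glob.Hom.app f n c
  counit_comp : Hom.app (Free.map f) n ≫ Hom.app (counitApp D) n = Hom.app (counitApp C) n ≫ σ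

variable {f}

/-- Provides the boundary condition required by `homSuccMk` when generators are sent to their images
under `f`. -/
theorem Represents.bdry {n : ℕ} {σ : C.trunc n ⟶ D.trunc n} (hσ : Represents f σ)
    (c : (level (n + 1)).Cell (C.trunc (n + 1))) :
    D.bdry (n := n) (Glob.Hom.app f (n + 1) c) = (level n).sphMap σ (C.bdry c) := by
  refine (level n).sph_ext ?_ ?_
  · rw [Level.pr₁_map, hσ.cellMap_eq]
    exact (Glob.Hom.app_src f c).symm
  · rw [Level.pr₂_map, hσ.cellMap_eq]
    exact (Glob.Hom.app_tgt f c).symm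

/-- The counits are identities in dimension `0`, so the second condition repeats the first. -/
theorem represents_zero (σ : C.trunc 0 ⟶ D.trunc 0)
    (h : ∀ c : (level 0).Cell (C.trunc 0), (level 0).cellMap σ c = Glob.Hom.app f 0 c) :
    Represents f σ where
  cellMap_eq := h
  counit_comp := ConcreteCategory.hom_ext (C := Type u) _ _ (fun c => (h c).symm)

/-- The core of fullness: agreement with `f` on generators propagates to coherences, since
strictness lets `f` be computed on a coherence through a formal cell that evaluates to it. -/
theorem Represents.succ (hf : IsStrict f) {n : ℕ} {σ : C.trunc (n + 1) ⟶ D.trunc (n + 1)}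
    (hσ : Represents f (restrict σ))
    (hV : ∀ v : CompSucc.V (P := level n) (C.trunc (n + 1)), (level (n + 1)).cellMap σ
      (CellSucc.var (P := level n) v) = Glob.Hom.app f (n + 1) (CellSucc.var (P := level n) v)) :
    Represents f σ := by
  have key : ∀ c : (level (n + 1)).Cell (C.trunc (n + 1)),
      (level (n + 1)).cellMap σ c = Glob.Hom.app f (n + 1) c := by
    intro c
    induction c using CellSucc.induction (P := level n) with
    | var v => exact hV v
    | coh B hB A hA τ ih =>
      -- The bound on `dim B` is what allows `τ`, defined only up to dimension `n + 1`, to be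
      -- transposed to a map of globular sets.
      have hX : ∀ k, (posGlob.{u} B).cell k → k ≤ n + 1 := fun k p => (Pos.le_dim p).trans hB
      let τ' : (Free.obj (posGlob.{u} B)).trunc (n + 1) ⟶ C.trunc (n + 1) := τ
      let t := transpose hX τ'
      have ht : Hom.app (Free.map t) (n + 1) ≫ Hom.app (counitApp C) (n + 1) = τ' :=
        free_transpose_counit hX τ'
      -- The formal coherence over `Free (Cell C)` whose evaluation is the given cell; strictness is
      -- applied to it.
      let c' : (level (n + 1)).Cell ((Free.obj (Cell.obj C)).trunc (n + 1)) :=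
        CellSucc.coh (P := level n) B hB A hA (Hom.app (Free.map t) (n + 1))
      have hc' : (level (n + 1)).cellMap (Hom.app (counitApp C) (n + 1)) c' =
          CellSucc.coh (P := level n) B hB A hA τ :=
        congrArg (CellSucc.coh (P := level n) B hB A hA) ht
      -- Below the top dimension this follows from `counit_comp` for `restrict σ`, which is why
      -- `Represents` carries that condition. On a top-dimensional position `p` both sides equal the
      -- image under `f` of the cell `τ p`, by the structural induction hypothesis.
      have hcomp : (Hom.app (Free.map t) (n + 1) ≫ Hom.app (Free.map f) (n + 1)) ≫
          Hom.app (counitApp D) (n + 1) = τ' ≫ σ := by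
        refine hom_succ_ext (C := Free.obj (posGlob.{u} B)) ?_ ?_
        · rw [← ht]
          simp only [restrict_comp, restrict_app, Category.assoc, hσ.counit_comp]
        · intro p
          refine Eq.trans ?_ (ih p).symm
          have h₁ := cellMap_free_counit (t ≫ f) (n + 1) p
          rw [Free.map_comp] at h₁
          refine Eq.trans h₁ (congrArg (Glob.Hom.app f (n + 1)) ?_)
          have h₂ := congrArg (fun ρ => (level (n + 1)).cellMap ρ ((level (n + 1)).gen _ p)) ht
          exact (cellMap_free_counit t (n + 1) p).symm.trans h₂
      have h := hf (n + 1) c'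
      rw [hc'] at h
      refine Eq.trans ?_ h
      exact (congrArg (CellSucc.coh (P := level n) B hB A hA) hcomp).symm
  -- The generators of `Free (Cell C)` are all the cells of `C`, so commuting with the counits needs
  -- `key` on every cell.
  refine ⟨key, hom_succ_ext ?_ ?_⟩
  · simp only [restrict_comp, restrict_app, hσ.counit_comp]
  · intro c
    refine Eq.trans ?_ (key c).symm
    rfl

/-- The truncations of the homomorphism of computads induced by a strict functor. -/
def liftAux (hf : IsStrict f) : ∀ n : ℕ, {σ : C.trunc n ⟶ D.trunc n // Represents f σ}
  | 0 => ⟨TypeCat.ofHom (X := C.trunc 0) (Y := D.trunc 0) (Glob.Hom.app f 0),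
      represents_zero _ fun _ => rfl⟩
  | n + 1 => ⟨homSuccMk (liftAux hf n).1
      (fun v => Glob.Hom.app f (n + 1) (CellSucc.var (P := level n) v))
      (fun _ => (liftAux hf n).2.bdry _),
      -- The restriction of the extension is the previous stage, and its values on generators are
      -- those of `f` by construction.
      Represents.succ hf ((restrict_homSuccMk _ _ _).symm ▸ (liftAux hf n).2) fun _ => rfl⟩

/-- The homomorphism of computads induced by a strict functor. -/
def lift (hf : IsStrict f) : C ⟶ D :=
  Computad.Hom.mk (C := C) (D := D) (fun n => (liftAux hf n).1) (fun n => by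
    have h : restrict (liftAux hf (n + 1)).1 = (liftAux hf n).1 :=
      restrict_homSuccMk (liftAux hf n).1 _ fun _ => (liftAux hf n).2.bdry _
    rw [← h, restrict, eqToHom_trans_assoc, eqToHom_refl, Category.id_comp])

theorem Cell_map_lift (hf : IsStrict f) : Cell.map (lift hf) = f :=
  Glob.hom_ext fun n c => (liftAux hf n).2.cellMap_eq c

end Lift

-- Fullness and faithfulness of the comparison functor

/-- The underlying morphism of a strict functor commutes with the evaluation maps. -/
theorem isStrict_of_algebraHom {C D : Computad.{u}} (F : Kw.obj C ⟶ Kw.obj D) :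
    IsStrict (C := C) (D := D) (Monad.Algebra.Hom.f F) := fun n c =>
  congrArg (fun g : (fcW.obj (Kw.obj C).A ⟶ (Kw.obj D).A) => Glob.Hom.app g n c)
    -- The structure maps of the two algebras are the images of the counits under `Cell`, so the
    -- algebra square, read on each cell, is the strictness condition.
    (Monad.Algebra.Hom.h F)

instance : Kw.{u}.Full where
  map_surjective F :=
    ⟨lift (isStrict_of_algebraHom F), Monad.Algebra.Hom.ext (Cell_map_lift _)⟩

instance : Kw.{u}.Faithful where
  map_injective {C D _ _} h := Computad.hom_ext fun _ => trunc_hom_ext fun k c =>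
    congrArg (fun G : Kw.obj C ⟶ Kw.obj D => Glob.Hom.app (Monad.Algebra.Hom.f G) k c) h

end WeakOmega

theorem mainTheorem7 :
    WeakOmega.Kw.{u}.Full ∧ WeakOmega.Kw.{u}.Faithful :=
  ⟨inferInstance, inferInstance⟩
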